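/- Let $\mathcal H$ be a finite-dimensional complex Hilbert space of dimension at least $2$, and let $|\Psi\rangle\in\mathcal H$ be a unit vector (for example an $n$-qudit graph state $|G\rangle$). For $0<\lambda<1$ put $\nu:=1-\lambda$ and $\Omega:=|\Psi\rangle\langle\Psi|+\lambda(1-|\Psi\rangle\langle\Psi|)$. For integers $k,N\ge 0$ and a state (density operator) $\rho$ on $\mathcal H^{\otimes(N+1)}$ that is permutation invariant (that is, invariant under conjugation by every permutation of the $N+1$ tensor factors), put $$p_k(\rho):=\sum_{i=0}^{k}\binom Ni\operatorname{tr}\big(\big[\Omega^{\otimes(N-i)}\otimes(1-\Omega)^{\otimes i}\otimes 1\big]\rho\big),$$ $$f_k(\rho):=\sum_{i=0}^{k}\binom Ni\operatorname{tr}\big(\big[\Omega^{\otimes(N-i)}\otimes(1-\Omega)^{\otimes i}\otimes |\Psi\rangle\langle\Psi|\big]\rho\big),$$ $F_k(\rho):=f_k(\rho)/p_k(\rho)$ when $p_k(\rho)>0$, and, for $0<\delta\le 1$, $$\bar\epsilon_\lambda(k,N,\delta):=1-\min_\rho\{F_k(\rho)\mid p_k(\rho)\ge\delta\},$$ where the minimum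 is over all permutation-invariant states $\rho$ on $\mathcal H^{\otimes (N+1)}$. Suppose $0<\lambda,\epsilon<1$, $0<\delta\le 1/4$, and $N,k$ are nonnegative integers. If $\nu\epsilon N\le k\le N-1$, then $\bar\epsilon_\lambda(k,N,\delta)>\epsilon$. If $k\le l(\lambda,N,\epsilon,\delta)$, then $\bar\epsilon_\lambda(k,N,\delta)\le\epsilon$, where $$l(\lambda,N,\epsilon,\delta):=\left\lfloor \nu\epsilon N-\frac{\sqrt{N\epsilon\ln\delta^{-1}}}{\lambda}-\frac{\ln\delta^{-1}}{2\lambda\nu}-\frac{2\nu}{\lambda}\right\rfloor .$$ -/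

import Mathlib

open scoped ComplexOrder

/- Operators on a finite-dimensional Hilbert space `H` with orthonormal basis indexed by `ι` are the
matrices `Matrix ι ι ℂ`.  The space `H^{⊗ m}` has the product basis indexed by `Fin m → ι`, so that
operators on it are the matrices `Matrix (Fin m → ι) (Fin m → ι) ℂ`. -/
namespace QSV

set_option linter.unusedSectionVars false

variable {ι : Type*} [Fintype ι] [DecidableEq ι]

/-- The tensor product `A 0 ⊗ A 1 ⊗ ⋯ ⊗ A (m - 1)` of operators on `H`, in the product basis. -/
def tensorOp {m : ℕ} (A : Fin m → Matrix ι ι ℂ) : Matrix (Fin m → ι) (Fin m → ι) ℂ :=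
  Matrix.of fun x y => ∏ j, A j (x j) (y j)

/-- Density operators: positive semidefinite of trace one. -/
def IsDensity {κ : Type*} [Fintype κ] (ρ : Matrix κ κ ℂ) : Prop :=
  ρ.PosSemidef ∧ ρ.trace = 1

/-- `ρ` is invariant under conjugation by the unitary that permutes the `m` tensor factors,
for every permutation of the factors. -/
def IsPermInvariant {m : ℕ} (ρ : Matrix (Fin m → ι) (Fin m → ι) ℂ) : Prop :=
  ∀ σ : Equiv.Perm (Fin m), ∀ x y : Fin m → ι, ρ (x ∘ σ) (y ∘ σ) = ρ x y

/-- The rank-one operator `|ψ⟩⟨ψ|`. -/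
def proj (ψ : EuclideanSpace ℂ ι) : Matrix ι ι ℂ :=
  Matrix.of fun a b => ψ a * star (ψ b)

/-- The homogeneous verification operator `Ω = |ψ⟩⟨ψ| + lam (1 - |ψ⟩⟨ψ|)`. -/
noncomputable def strategy (ψ : EuclideanSpace ℂ ι) (lam : ℝ) : Matrix ι ι ℂ :=
  proj ψ + (lam : ℂ) • (1 - proj ψ)

/-- The operator `Ω^{⊗ (N - i)} ⊗ (1 - Ω)^{⊗ i} ⊗ T` on `H^{⊗ (N + 1)}` (used for `i ≤ N`). -/
noncomputable def testOp (Ω T : Matrix ι ι ℂ) (N i : ℕ) :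
    Matrix (Fin (N + 1) → ι) (Fin (N + 1) → ι) ℂ :=
  tensorOp fun j : Fin (N + 1) =>
    if (j : ℕ) < N - i then Ω else if (j : ℕ) < N then 1 - Ω else T

/-- `∑_{i ≤ k} (N choose i) tr ([Ω^{⊗ (N - i)} ⊗ (1 - Ω)^{⊗ i} ⊗ T] ρ)`, where `Ω` is the homogeneous
strategy (the trace is real for Hermitian `T` and `ρ`; the terms with `i > N` vanish). -/
noncomputable def acceptWith (ψ : EuclideanSpace ℂ ι) (lam : ℝ) (k N : ℕ) (T : Matrix ι ι ℂ)
    (ρ : Matrix (Fin (N + 1) → ι) (Fin (N + 1) → ι) ℂ) : ℝ :=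
  ∑ i ∈ Finset.range (k + 1),
    (N.choose i : ℝ) * (testOp (strategy ψ lam) T N i * ρ).trace.re

/-- The probability `p_k(ρ)` that at most `k` failures are observed in `N` tests. -/
noncomputable def acceptProb (ψ : EuclideanSpace ℂ ι) (lam : ℝ) (k N : ℕ)
    (ρ : Matrix (Fin (N + 1) → ι) (Fin (N + 1) → ι) ℂ) : ℝ :=
  acceptWith ψ lam k N 1 ρ

/-- The fidelity `F_k(ρ) = f_k(ρ) / p_k(ρ)` between `ψ` and the reduced state on the last system
conditioned on acceptance. -/
noncomputable def condFidelity (ψ : EuclideanSpace ℂ ι) (lam : ℝ) (k N : ℕ)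
    (ρ : Matrix (Fin (N + 1) → ι) (Fin (N + 1) → ι) ℂ) : ℝ :=
  acceptWith ψ lam k N (proj ψ) ρ / acceptProb ψ lam k N ρ

/-- The permutation-invariant states on `H^{⊗ (N + 1)}` accepted with probability at least `δ`. -/
def feasible (ψ : EuclideanSpace ℂ ι) (lam : ℝ) (k N : ℕ) (δ : ℝ) :
    Set (Matrix (Fin (N + 1) → ι) (Fin (N + 1) → ι) ℂ) :=
  {ρ | IsDensity ρ ∧ IsPermInvariant ρ ∧ δ ≤ acceptProb ψ lam k N ρ}

/-- The guaranteed infidelity `1 - min {F_k(ρ) | p_k(ρ) ≥ δ}`, `ρ` ranging over permutation-invariant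
states (the minimum is attained, see `isLeast_condFidelity`). -/
noncomputable def guaranteedInfidelity (ψ : EuclideanSpace ℂ ι) (lam : ℝ) (k N : ℕ) (δ : ℝ) : ℝ :=
  1 - sInf (condFidelity ψ lam k N '' feasible ψ lam k N δ)

/-- The integer `⌊ν ε N - √(N ε ln δ⁻¹) / lam - ln δ⁻¹ / (2 lam ν) - 2 ν / lam⌋`, `ν = 1 - lam`. -/
noncomputable def failureBound (lam : ℝ) (N : ℕ) (ε δ : ℝ) : ℤ :=
  ⌊(1 - lam) * ε * N - Real.sqrt (N * ε * Real.log δ⁻¹) / lam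
    - Real.log δ⁻¹ / (2 * lam * (1 - lam)) - 2 * (1 - lam) / lam⌋

/-! The minimum in the definition of the guaranteed infidelity exists. -/

theorem trace_tensorOp_mul {m : ℕ} (A B : Fin m → Matrix ι ι ℂ) :
    (tensorOp A * tensorOp B).trace = ∏ j, (A j * B j).trace := by
  simp only [Matrix.trace, Matrix.diag_apply, Matrix.mul_apply, tensorOp, Matrix.of_apply]
  rw [Finset.prod_univ_sum]
  simp only [Fintype.piFinset_univ]
  refine Finset.sum_congr rfl fun x _ => ?_
  rw [Finset.prod_univ_sum]
  simp only [Fintype.piFinset_univ, Finset.prod_mul_distrib]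

theorem trace_proj {ψ : EuclideanSpace ℂ ι} (hψ : ‖ψ‖ = 1) : (proj ψ).trace = 1 := by
  have h := EuclideanSpace.norm_sq_eq ψ
  rw [hψ] at h
  simp only [Matrix.trace, Matrix.diag_apply, proj, Matrix.of_apply]
  have h2 : ∀ a, ψ a * star (ψ a) = ((‖ψ a‖ ^ 2 : ℝ) : ℂ) := fun a => by
    simp [Complex.mul_conj, Complex.normSq_eq_norm_sq]
  simp only [h2]
  rw [← Complex.ofReal_sum, ← h]
  simp

theorem proj_mul_proj {ψ : EuclideanSpace ℂ ι} (hψ : ‖ψ‖ = 1) : proj ψ * proj ψ = proj ψ := by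
  have h := trace_proj hψ
  simp only [Matrix.trace, Matrix.diag_apply, proj, Matrix.of_apply] at h
  ext a b
  simp only [Matrix.mul_apply, proj, Matrix.of_apply]
  calc ∑ c, ψ a * star (ψ c) * (ψ c * star (ψ b))
      = ψ a * star (ψ b) * ∑ c, ψ c * star (ψ c) := by
        rw [Finset.mul_sum]; exact Finset.sum_congr rfl fun c _ => by ring
    _ = _ := by rw [h, mul_one]

theorem isDensity_tensorOp_proj {ψ : EuclideanSpace ℂ ι} (hψ : ‖ψ‖ = 1) (m : ℕ) :
    IsDensity (tensorOp fun _ : Fin m => proj ψ) := by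
  constructor
  · have : (tensorOp fun _ : Fin m => proj ψ)
        = Matrix.vecMulVec (fun x : Fin m → ι => ∏ j, ψ (x j))
          (star fun x : Fin m → ι => ∏ j, ψ (x j)) := by
      ext x y
      simp [tensorOp, proj, Matrix.vecMulVec_apply, Finset.prod_mul_distrib]
    rw [this]
    exact Matrix.posSemidef_vecMulVec_self_star _
  · have h1 : (1 : Matrix (Fin m → ι) (Fin m → ι) ℂ) = tensorOp fun _ => 1 := by
      ext x y
      simp only [tensorOp, Matrix.of_apply, Matrix.one_apply, Finset.prod_ite_zero,
        Finset.prod_const_one, Finset.mem_univ, forall_true_left, funext_iff]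
    rw [← Matrix.one_mul (tensorOp _), h1, trace_tensorOp_mul]
    simp [trace_proj hψ]

theorem isPermInvariant_tensorOp (A : Matrix ι ι ℂ) (m : ℕ) :
    IsPermInvariant (tensorOp fun _ : Fin m => A) := by
  intro σ x y
  simp only [tensorOp, Matrix.of_apply, Function.comp_apply]
  exact Equiv.prod_comp σ fun j => A (x j) (y j)

theorem acceptProb_tensorOp_proj {ψ : EuclideanSpace ℂ ι} (hψ : ‖ψ‖ = 1) (lam : ℝ) (k N : ℕ) :
    acceptProb ψ lam k N (tensorOp fun _ => proj ψ) = 1 := by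
  have hΩ : strategy ψ lam * proj ψ = proj ψ := by
    simp [strategy, Matrix.add_mul, Matrix.sub_mul, proj_mul_proj hψ]
  rw [acceptProb, acceptWith, Finset.sum_eq_single_of_mem 0 (by simp)]
  · rw [testOp, trace_tensorOp_mul, Finset.prod_eq_one]
    · simp
    · intro j _
      rcases Nat.lt_or_ge j N with h | h
      · simp [h, hΩ, trace_proj hψ]
      · simp [not_lt.2 h, trace_proj hψ]
  · intro i _ hi
    rcases Nat.lt_or_ge N i with h | h
    · simp [Nat.choose_eq_zero_of_lt h]
    · rw [testOp, trace_tensorOp_mul,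
        Finset.prod_eq_zero (Finset.mem_univ (⟨N - i, by omega⟩ : Fin (N + 1)))]
      · simp
      · have : N - i < N := by omega
        simp [this, Matrix.sub_mul, hΩ]

theorem feasible_nonempty {ψ : EuclideanSpace ℂ ι} (hψ : ‖ψ‖ = 1) (lam : ℝ) (k N : ℕ) {δ : ℝ}
    (hδ : δ ≤ 1) : (feasible ψ lam k N δ).Nonempty :=
  ⟨_, isDensity_tensorOp_proj hψ _, isPermInvariant_tensorOp _ _,
    by rw [acceptProb_tensorOp_proj hψ]; exact hδ⟩

theorem continuous_acceptWith (ψ : EuclideanSpace ℂ ι) (lam : ℝ) (k N : ℕ) (T : Matrix ι ι ℂ) :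
    Continuous (acceptWith ψ lam k N T) := by
  unfold acceptWith
  refine continuous_finsetSum _ fun i _ => continuous_const.mul ?_
  exact Complex.continuous_re.comp (continuous_const.matrix_mul continuous_id).matrix_trace

theorem isCompact_isDensity {κ : Type*} [Fintype κ] [DecidableEq κ] :
    IsCompact {ρ : Matrix κ κ ℂ | IsDensity ρ} := by
  have hK : IsCompact {ρ : Matrix κ κ ℂ | ∀ a b, ρ a b ∈ Metric.closedBall (0 : ℂ) 1} := by
    have h := isCompact_univ_pi (X := fun _ : κ => κ → ℂ)
      (s := fun _ => Set.univ.pi fun _ => Metric.closedBall (0 : ℂ) 1)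
      fun _ => isCompact_univ_pi fun _ => isCompact_closedBall _ _
    have hset : {ρ : Matrix κ κ ℂ | ∀ a b, ρ a b ∈ Metric.closedBall (0 : ℂ) 1}
        = Set.univ.pi fun _ : κ => Set.univ.pi fun _ : κ => Metric.closedBall (0 : ℂ) 1 :=
      Set.ext fun ρ => ⟨fun h a _ b _ => h a b, fun h a b => h a trivial b trivial⟩
    rw [hset]
    exact h
  refine hK.of_isClosed_subset ?_ ?_
  · have hset : {ρ : Matrix κ κ ℂ | IsDensity ρ}
        = {ρ | star ρ = ρ} ∩ (⋂ v : κ → ℂ, {ρ | 0 ≤ dotProduct (star v) (ρ.mulVec v)})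
          ∩ {ρ | ρ.trace = 1} := by
      ext ρ
      simp only [IsDensity, Matrix.posSemidef_iff_dotProduct_mulVec, Set.mem_inter_iff,
        Set.mem_ofPred_eq, Set.mem_iInter]
      rfl
    rw [hset]
    refine ((isClosed_eq (continuous_star) continuous_id).inter
      (isClosed_iInter fun v => ?_)).inter
      (isClosed_eq continuous_id.matrix_trace continuous_const)
    exact isClosed_le continuous_const
      (continuous_const.dotProduct (continuous_id.matrix_mulVec continuous_const))
  · rintro ρ ⟨hpos, htr⟩ a b
    have hd : ∀ c, ρ c c = ((ρ c c).re : ℂ) := fun c => by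
      have h := (Complex.le_def.1 (hpos.diag_nonneg (i := c))).2
      exact Complex.ext rfl (by simpa using h.symm)
    have hd0 : ∀ c, 0 ≤ (ρ c c).re := fun c => (Complex.le_def.1 (hpos.diag_nonneg (i := c))).1
    have hsum : ∑ c, (ρ c c).re = 1 := by
      simpa [Matrix.trace] using congrArg Complex.re htr
    have hd1 : ∀ c, (ρ c c).re ≤ 1 := fun c =>
      hsum ▸ Finset.single_le_sum (fun c _ => hd0 c) (Finset.mem_univ c)
    have hdet := (hpos.submatrix ![a, b]).det_nonneg
    rw [Matrix.det_fin_two] at hdet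
    simp only [Matrix.submatrix_apply, Matrix.cons_val_zero, Matrix.cons_val_one] at hdet
    rw [← hpos.1.apply b a, hd a, hd b, Complex.star_def, Complex.mul_conj] at hdet
    have h2 : Complex.normSq (ρ a b) ≤ (ρ a a).re * (ρ b b).re := by
      have := (Complex.le_def.1 hdet).1
      simpa using this
    rw [mem_closedBall_zero_iff]
    rw [Complex.normSq_eq_norm_sq] at h2
    have := mul_le_one₀ (hd1 a) (hd0 b) (hd1 b)
    exact (sq_le_one_iff₀ (norm_nonneg _)).1 (h2.trans this)

theorem isLeast_condFidelity {ψ : EuclideanSpace ℂ ι} (hψ : ‖ψ‖ = 1) (lam : ℝ) (k N : ℕ) {δ : ℝ}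
    (hδ0 : 0 < δ) (hδ : δ ≤ 1) :
    IsLeast (condFidelity ψ lam k N '' feasible ψ lam k N δ)
      (1 - guaranteedInfidelity ψ lam k N δ) := by
  have hc : IsCompact (feasible ψ lam k N δ) := by
    refine isCompact_isDensity.of_isClosed_subset ?_ fun ρ h => h.1
    have hset : feasible ψ lam k N δ = {ρ | IsDensity ρ} ∩
        ((⋂ σ : Equiv.Perm (Fin (N + 1)), ⋂ x : Fin (N + 1) → ι, ⋂ y : Fin (N + 1) → ι,
          {ρ | ρ (x ∘ σ) (y ∘ σ) = ρ x y}) ∩ {ρ | δ ≤ acceptProb ψ lam k N ρ}) := by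
      ext ρ
      simp [feasible, IsPermInvariant]
    rw [hset]
    refine isCompact_isDensity.isClosed.inter (IsClosed.inter ?_ ?_)
    · exact isClosed_iInter fun σ => isClosed_iInter fun x => isClosed_iInter fun y =>
        isClosed_eq (continuous_id.matrix_elem _ _) (continuous_id.matrix_elem _ _)
    · exact isClosed_le continuous_const (continuous_acceptWith ψ lam k N 1)
  have hcont : ContinuousOn (condFidelity ψ lam k N) (feasible ψ lam k N δ) :=
    ContinuousOn.div (continuous_acceptWith _ _ _ _ _).continuousOn
      (continuous_acceptWith _ _ _ _ _).continuousOn fun ρ h => (hδ0.trans_le h.2.2).ne'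
  rw [guaranteedInfidelity, sub_sub_cancel]
  exact (hc.image_of_continuousOn hcont).isLeast_sInf ((feasible_nonempty hψ lam k N hδ).image _)

end QSV

/-! Write t = 1 - `lam`. By permutation invariance, a state enters only through the law q of the
number j of factors orthogonal to `ψ`; given the configuration, each such factor fails a test
independently with probability t, and the others never fail. Everything reduces to a mixture over j
of binomial (j, t) variables.

Upper bound. Imagine that the last factor is tested too, and let w z be the probability of exactly z
failures among the N + 1 tests. By exchangeability, t (N + 1) times the probability of acceptance
with an orthogonal last factor is the sum of z w z over 1 ≤ z ≤ k + 1 (`exists_binomial_mixture`).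
The terms z ≤ k contribute at most k p, where p is the acceptance probability. With G = t ε N - k,
it remains to bound (k + 1) w (k + 1) by G p. As p ≥ δ, it suffices that for every j the next mass,
times k + 1, is at most 3/4 G V + 1/4 G δ, where V is the tail (`binomialMass_succ_le`). This is
uniform in j because a large ratio of next mass to tail forces the tail itself to be exponentially
small (`binomialTail_le_exp`).

Lower bound. The product of N + 1 isotropic states of infidelity θ has conditional infidelity θ and
is accepted with the binomial (N, t θ) probability of at most k failures. At θ = ε this is at least
1/2 by a median estimate (`half_le_binomialTail`), so by continuity it exceeds 1/4 ≥ δ for some θ >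
ε. -/

namespace QSV

/-! ### Binomial tails: derivative, truncated mean, monotone likelihood ratio -/

/-- The probability of `i` successes in `j` Bernoulli trials with success probability `s`. -/
noncomputable def binomialMass (j i : ℕ) (s : ℝ) : ℝ := j.choose i * s ^ i * (1 - s) ^ (j - i)

/-- The probability of at most `k` successes in `j` Bernoulli trials with success probability `s`. -/
noncomputable def binomialTail (j k : ℕ) (s : ℝ) : ℝ :=
  ∑ i ∈ Finset.range (k + 1), binomialMass j i s

/-- The mean of the positive part of `k - X`, with `X` binomial. -/
noncomputable def binomialDeficit (j k : ℕ) (s : ℝ) : ℝ :=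
  ∑ i ∈ Finset.range (k + 1), ((k : ℝ) - i) * binomialMass j i s

theorem binomialMass_nonneg (j i : ℕ) {s : ℝ} (h0 : 0 ≤ s) (h1 : s ≤ 1) :
    0 ≤ binomialMass j i s := by
  have : 0 ≤ 1 - s := by linarith
  unfold binomialMass; positivity

theorem binomialTail_nonneg (j k : ℕ) {s : ℝ} (h0 : 0 ≤ s) (h1 : s ≤ 1) :
    0 ≤ binomialTail j k s :=
  Finset.sum_nonneg fun i _ => binomialMass_nonneg j i h0 h1

theorem binomialTail_pos (j k : ℕ) {s : ℝ} (h0 : 0 ≤ s) (h1 : s < 1) :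
    0 < binomialTail j k s := by
  refine Finset.sum_pos' (fun i _ => binomialMass_nonneg j i h0 h1.le) ⟨0, by simp, ?_⟩
  have : 0 < 1 - s := by linarith
  unfold binomialMass; simp only [Nat.choose_zero_right]; positivity

theorem binomialDeficit_nonneg (j k : ℕ) {s : ℝ} (h0 : 0 ≤ s) (h1 : s ≤ 1) :
    0 ≤ binomialDeficit j k s := by
  refine Finset.sum_nonneg fun i hi => mul_nonneg ?_ (binomialMass_nonneg j i h0 h1)
  have : (i : ℝ) ≤ k := by exact_mod_cast Nat.lt_succ_iff.1 (Finset.mem_range.1 hi)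
  linarith

theorem binomialTail_zero (j k : ℕ) : binomialTail j k 0 = 1 := by
  rw [binomialTail, Finset.sum_eq_single_of_mem 0 (by simp)]
  · simp [binomialMass]
  · intro i _ hi; simp [binomialMass, hi]

theorem choose_succ_mul (j k : ℕ) :
    ((k : ℝ) + 1) * j.choose (k + 1) = j.choose k * ((j - k : ℕ) : ℝ) := by
  have := Nat.choose_succ_right_eq j k
  rw [mul_comm]; exact_mod_cast this

/-- The derivatives of the successive masses telescope, leaving one boundary term, a beta density up
to sign. -/
theorem hasDerivAt_binomialTail (j k : ℕ) (s : ℝ) :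
    HasDerivAt (binomialTail j k)
      (-(((k : ℝ) + 1) * j.choose (k + 1) * s ^ k * (1 - s) ^ (j - (k + 1)))) s := by
  have hsub : HasDerivAt (fun x : ℝ => 1 - x) (-1) s := by
    simpa using (hasDerivAt_id s).const_sub 1
  induction k with
  | zero =>
    have h := hsub.pow j
    have he : binomialTail j 0 = fun x => (1 - x) ^ j := by
      ext x; simp [binomialTail, binomialMass]
    rw [he]
    refine h.congr_deriv ?_
    simp
  | succ k ih =>
    have he : binomialTail j (k + 1) =
        fun x => binomialTail j k x + j.choose (k + 1) * x ^ (k + 1) * (1 - x) ^ (j - (k + 1)) := by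
      ext x; rw [binomialTail, Finset.sum_range_succ]; rfl
    rw [he]
    have h := ih.add ((((hasDerivAt_id s).pow (k + 1)).const_mul (j.choose (k + 1) : ℝ)).mul
      (hsub.pow (j - (k + 1))))
    refine h.congr_deriv ?_
    have hc := choose_succ_mul j (k + 1)
    simp only [id, Nat.add_sub_cancel, Pi.pow_apply]
    rw [show j - (k + 1 + 1) = j - (k + 1) - 1 by omega] at *
    push_cast at hc ⊢
    linear_combination (s ^ (k + 1) * (1 - s) ^ (j - (k + 1) - 1)) * hc

theorem antitoneOn_binomialTail (j k : ℕ) : AntitoneOn (binomialTail j k) (Set.Icc 0 1) := by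
  refine antitoneOn_of_deriv_nonpos (convex_Icc 0 1)
    (fun s _ => (hasDerivAt_binomialTail j k s).continuousAt.continuousWithinAt)
    (fun s _ => (hasDerivAt_binomialTail j k s).differentiableAt.differentiableWithinAt) ?_
  intro s hs
  rw [interior_Icc] at hs
  rw [(hasDerivAt_binomialTail j k s).deriv]
  have h0 := hs.1
  have h1 : 0 < 1 - s := by linarith [hs.2]
  rw [neg_nonpos]; positivity

theorem binomialTail_le_one (j k : ℕ) {s : ℝ} (h0 : 0 ≤ s) (h1 : s ≤ 1) :
    binomialTail j k s ≤ 1 := by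
  rw [← binomialTail_zero j k]
  exact antitoneOn_binomialTail j k ⟨le_rfl, zero_le_one⟩ ⟨h0, h1⟩ h0

/-- The truncated mean of the binomial distribution. -/
theorem binomialMass_succ_eq (j k : ℕ) (s : ℝ) :
    (1 - s) * (((k : ℝ) + 1) * binomialMass j (k + 1) s) =
      (j * s - k) * binomialTail j k s + binomialDeficit j k s := by
  have key : ∀ k : ℕ, (1 - s) * (((k : ℝ) + 1) * binomialMass j (k + 1) s) =
      (j - k) * s * binomialMass j k s := by
    intro k
    unfold binomialMass
    have hc := choose_succ_mul j k
    rcases lt_trichotomy j k with h | h | h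
    · simp [Nat.choose_eq_zero_of_lt h, Nat.choose_eq_zero_of_lt (h.trans (Nat.lt_succ_self k))]
    · subst h; simp
    · rw [Nat.cast_sub h.le] at hc
      obtain ⟨d, rfl⟩ : ∃ d, j = k + 1 + d := ⟨j - (k + 1), by omega⟩
      rw [show k + 1 + d - (k + 1) = d by omega, show k + 1 + d - k = d + 1 by omega]
      linear_combination (s ^ (k + 1) * (1 - s) ^ (d + 1)) * hc
  -- The sum telescopes by `key`, since (1 - s) i + (j s - i) = (j - i) s.
  have main : ∀ k : ℕ, (1 - s) * (((k : ℝ) + 1) * binomialMass j (k + 1) s) =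
      ∑ i ∈ Finset.range (k + 1), (j * s - i) * binomialMass j i s := by
    intro k
    induction k with
    | zero => rw [key 0]; simp
    | succ k ih => rw [Finset.sum_range_succ, ← ih, key (k + 1)]; push_cast; ring
  rw [main, binomialTail, binomialDeficit, Finset.mul_sum, ← Finset.sum_add_distrib]
  exact Finset.sum_congr rfl fun i _ => by ring

/-- Monotone likelihood ratio: the mass at b over the mass at a is a constant times (s / (1 - s)) ^
(b - a), which increases with s. -/
theorem binomialMass_mul_le (j : ℕ) {a b : ℕ} (hab : a ≤ b) {s t : ℝ} (h0 : 0 ≤ s) (hst : s ≤ t)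
    (h1 : t ≤ 1) :
    binomialMass j a t * binomialMass j b s ≤ binomialMass j a s * binomialMass j b t := by
  rcases Nat.lt_or_ge j b with hj | hj
  · simp [binomialMass, Nat.choose_eq_zero_of_lt hj]
  obtain ⟨d, rfl⟩ := Nat.exists_eq_add_of_le hab
  obtain ⟨e, rfl⟩ := Nat.exists_eq_add_of_le hj
  unfold binomialMass
  rw [show a + d + e - a = e + d by omega, show a + d + e - (a + d) = e by omega]
  have ht : 0 ≤ t := h0.trans hst
  have hs1 : 0 ≤ 1 - s := by linarith
  have ht1 : 0 ≤ 1 - t := by linarith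
  have h : ((1 - t) * s) ^ d ≤ ((1 - s) * t) ^ d := by
    refine pow_le_pow_left₀ (by positivity) ?_ d
    nlinarith
  have hc : 0 ≤ ((a + d + e).choose a : ℝ) * (a + d + e).choose (a + d) *
    ((s * t) ^ a * ((1 - s) * (1 - t)) ^ e) := by positivity
  have := mul_le_mul_of_nonneg_left h hc
  simp only [mul_pow] at this
  rw [pow_add, pow_add, pow_add, pow_add]
  linarith

/-- Deficit over tail is the mean of k - X given X ≤ k. By the monotone likelihood ratio, a larger s
pushes the conditioned X upwards, so this mean decreases. -/
theorem binomialDeficit_mul_tail_le (j k : ℕ) {s t : ℝ} (h0 : 0 ≤ s) (hst : s ≤ t) (h1 : t ≤ 1) :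
    binomialDeficit j k t * binomialTail j k s ≤ binomialDeficit j k s * binomialTail j k t := by
  simp only [binomialDeficit, binomialTail, Finset.sum_mul_sum]
  rw [← sub_nonneg, ← Finset.sum_sub_distrib]
  simp only [← Finset.sum_sub_distrib]
  -- Single terms have no sign; pairing (a, b) with (b, a) produces the factor b - a times a
  -- likelihood-ratio difference.
  have hsymm : ∀ F : ℕ → ℕ → ℝ, (∀ a b, 0 ≤ F a b + F b a) →
      0 ≤ ∑ a ∈ Finset.range (k + 1), ∑ b ∈ Finset.range (k + 1), F a b := by
    intro F hF
    have h : 0 ≤ ∑ a ∈ Finset.range (k + 1), ∑ b ∈ Finset.range (k + 1), (F a b + F b a) :=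
      Finset.sum_nonneg fun a _ => Finset.sum_nonneg fun b _ => hF a b
    simp only [Finset.sum_add_distrib] at h
    rw [Finset.sum_comm (f := fun a b => F b a)] at h
    linarith
  refine hsymm _ fun a b => ?_
  rcases le_total a b with hab | hab
  · have h := binomialMass_mul_le j hab h0 hst h1
    have hc : (a : ℝ) ≤ b := by exact_mod_cast hab
    nlinarith
  · have h := binomialMass_mul_le j hab h0 hst h1
    have hc : (b : ℝ) ≤ a := by exact_mod_cast hab
    nlinarith

/-! ### Exponential tail bound and control of the next mass -/

/-- A tail bound in terms of the ratio between the next mass and the tail. -/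
theorem binomialTail_le_exp (j k : ℕ) {t y : ℝ} (ht0 : 0 < t) (ht1 : t < 1) (hy : 0 < y)
    (hyt : y * binomialTail j k t = (1 - t) * (((k : ℝ) + 1) * binomialMass j (k + 1) t)) :
    binomialTail j k t ≤ Real.exp (-(2 * t * y ^ 2 / (k + y))) := by
  set V := binomialTail j k
  set D := binomialDeficit j k
  have hk : (0 : ℝ) ≤ k := k.cast_nonneg
  have hky : (0 : ℝ) < k + y := by linarith
  -- J is a fictitious, real number of trials with mean k + y. The claim is Hoeffding's bound exp
  -- (-2 J (t - r) ^ 2) for J trials with threshold r = k / J.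
  set J : ℝ := (k + y) / t with hJ
  have hJ0 : 0 < J := by positivity
  have hJt : J * t = k + y := by rw [hJ]; field_simp
  set r : ℝ := k / J with hr
  have hr0 : 0 ≤ r := by positivity
  have hJr : J * r = k := by rw [hr]; field_simp
  have hrt : r < t := by
    have : J * r < J * t := by rw [hJr, hJt]; linarith
    exact lt_of_mul_lt_mul_left this hJ0.le
  have hVpos : ∀ s, 0 ≤ s → s < 1 → 0 < V s := fun s h0 h1 => binomialTail_pos j k h0 h1
  have hDt : D t = (J - j) * t * V t := by
    have := binomialMass_succ_eq j k t
    linear_combination -hyt - this - hJt * V t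
  have hder : ∀ s, 0 ≤ s → s < 1 → HasDerivAt (fun x => Real.log (V x) + 2 * J * (x - r) ^ 2)
      (-(((k : ℝ) + 1) * j.choose (k + 1) * s ^ k * (1 - s) ^ (j - (k + 1))) / V s
        + 4 * (J * s - k)) s := by
    intro s h0 h1
    have h := ((hasDerivAt_binomialTail j k s).log (hVpos s h0 h1).ne').add
      ((((hasDerivAt_id s).sub_const r).pow 2).const_mul (2 * J))
    refine h.congr_deriv ?_
    simp only [id]
    linear_combination (-4) * hJr
  -- It suffices that -V' / V ≥ 4 (J s - k) on [r, t]; integrating from r, where V ≤ 1, gives the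
  -- Gaussian exponent.
  have hanti : AntitoneOn (fun x => Real.log (V x) + 2 * J * (x - r) ^ 2) (Set.Icc r t) := by
    refine antitoneOn_of_deriv_nonpos (convex_Icc r t)
      (fun s hs => (hder s (hr0.trans hs.1) (hs.2.trans_lt ht1)).continuousAt.continuousWithinAt)
      (fun s hs => ?_) ?_
    · rw [interior_Icc] at hs
      exact (hder s (hr0.trans hs.1.le)
        (hs.2.trans ht1)).differentiableAt.differentiableWithinAt
    intro s hs
    rw [interior_Icc] at hs
    have hs0 : 0 < s := hr0.trans_lt hs.1
    have hs1 : s < 1 := hs.2.trans ht1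
    rw [(hder s hs0.le hs1).deriv]
    have hV := hVpos s hs0.le hs1
    have hVt := hVpos t ht0.le ht1
    have hmono := binomialDeficit_mul_tail_le j k hs0.le hs.2.le ht1.le
    change D t * V s ≤ D s * V t at hmono
    have hid := binomialMass_succ_eq j k s
    change _ = (j * s - k) * V s + D s at hid
    -- D / V decreases and equals (J - j) t at t, with J ≥ j because D is nonnegative; so it is at
    -- least (J - j) s at s. This replaces the unknown j by J.
    have hDs : (J - j) * s * V s ≤ D s := by
      have hD0 : 0 ≤ D t := binomialDeficit_nonneg j k ht0.le ht1.le
      have hJj : 0 ≤ J - j := by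
        rw [hDt] at hD0
        by_contra hcon
        push Not at hcon
        have := mul_pos ht0 hVt
        nlinarith
      rw [hDt] at hmono
      have h1 : (J - j) * t * V s ≤ D s := by
        refine le_of_mul_le_mul_right ?_ hVt
        linarith
      have h2 : (J - j) * s * V s ≤ (J - j) * t * V s := by
        have := hs.2.le
        gcongr
      exact h2.trans h1
    have hmass : (1 - s) * (((k : ℝ) + 1) * binomialMass j (k + 1) s) =
        s * (1 - s) * (((k : ℝ) + 1) * j.choose (k + 1) * s ^ k * (1 - s) ^ (j - (k + 1))) := by
      unfold binomialMass; ring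
    set f := ((k : ℝ) + 1) * j.choose (k + 1) * s ^ k * (1 - s) ^ (j - (k + 1)) with hf
    have hf0 : 0 ≤ f := by
      have : 0 ≤ 1 - s := by linarith
      positivity
    have hlow : (J * s - k) * V s ≤ s * (1 - s) * f := by
      rw [← hmass, hid]; linarith
    have hfour : s * (1 - s) * f ≤ f / 4 := by nlinarith [sq_nonneg (s - 1 / 2)]
    rw [neg_div, neg_add_nonpos_iff, le_div_iff₀ hV]
    linarith
  have hle := hanti ⟨le_rfl, hrt.le⟩ ⟨hrt.le, le_rfl⟩ hrt.le
  simp only [sub_self] at hle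
  have hVr : Real.log (V r) ≤ 0 := Real.log_nonpos (binomialTail_nonneg j k hr0 (by linarith))
    (binomialTail_le_one j k hr0 (by linarith))
  have hlog : Real.log (V t) ≤ -(2 * t * y ^ 2 / (k + y)) := by
    have h1 : 2 * J * (t - r) ^ 2 = 2 * t * y ^ 2 / (k + y) := by
      have h2 : t - r = t * y / (k + y) := by
        rw [hr, hJ]; field_simp; ring
      rw [h2, hJ]; field_simp
    rw [← h1]
    nlinarith
  rwa [Real.log_le_iff_le_exp (hVpos t ht0.le ht1)] at hlog

/-- A bound of the next mass by an affine function of the tail. -/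
theorem binomialMass_succ_le (j k : ℕ) {t G M L : ℝ} (ht0 : 0 < t) (ht1 : t < 1) (hG : 0 < G)
    (hM : t * M = k + G) (hL : Real.log 4 ≤ L) (hGL : M * L ≤ ((1 - t) * G) ^ 2) :
    ((k : ℝ) + 1) * binomialMass j (k + 1) t ≤
      3 / 4 * G * binomialTail j k t + 1 / 4 * G * Real.exp (-L) := by
  have hV := binomialTail_pos j k ht0.le ht1
  set V := binomialTail j k t
  have hl : 0 < 1 - t := by linarith
  have hk : (0 : ℝ) ≤ k := k.cast_nonneg
  -- x is the next mass, times k + 1, in units of G V. Only x > 3/4 needs the tail bound, applied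
  -- with y = x (1 - t) G.
  obtain ⟨x, hx⟩ : ∃ x, x * G * V = ((k : ℝ) + 1) * binomialMass j (k + 1) t :=
    ⟨((k : ℝ) + 1) * binomialMass j (k + 1) t / (G * V), by field_simp⟩
  rw [← hx]
  have hL1 : 1 ≤ L := by
    refine le_trans ?_ hL
    rw [Real.le_log_iff_exp_le (by norm_num)]
    linarith [Real.exp_one_lt_d9]
  rcases le_or_gt x (3 / 4) with h34 | h34
  · have : x * G * V ≤ 3 / 4 * G * V := by gcongr
    have := Real.exp_pos (-L)
    nlinarith
  have hx0 : 0 < x := by linarith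
  set y₀ := (1 - t) * G with hy₀
  have hy₀0 : 0 < y₀ := by positivity
  have hy₀G : y₀ ≤ G := by nlinarith
  have htail := binomialTail_le_exp j k ht0 ht1 (y := x * y₀) (by positivity)
    (by rw [← hx, hy₀]; ring)
  change V ≤ _ at htail
  have hMpos : 0 < M := by
    have : 0 < t * M := by rw [hM]; linarith
    exact pos_of_mul_pos_right this ht0.le
  -- Since (k + y₀) L ≤ t y₀ ^ 2, any c below x ^ 2 (k + y₀) / (k + x y₀) is admissible: c = x ^ 2
  -- for x ≤ 1, and c = x for x > 1.
  have hexp : ∀ c, c * (k + x * y₀) ≤ x ^ 2 * (k + y₀) → 0 ≤ c → V ≤ Real.exp (-(2 * c * L)) := by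
    intro c hc hc0
    refine htail.trans (Real.exp_le_exp.2 (neg_le_neg ?_))
    rw [le_div_iff₀ (by positivity)]
    have h1 : (k + y₀) * L ≤ t * y₀ ^ 2 := by
      have : (k + y₀) * L ≤ t * M * L := by gcongr; linarith
      have : t * (M * L) ≤ t * y₀ ^ 2 := by gcongr
      linarith
    have h2 : c * (k + x * y₀) * L ≤ x ^ 2 * (k + y₀) * L := by gcongr
    have h3 : x ^ 2 * ((k + y₀) * L) ≤ x ^ 2 * (t * y₀ ^ 2) := by gcongr
    nlinarith
  rcases le_or_gt x 1 with hx1 | hx1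
  · have h := hexp (x ^ 2) (by gcongr; nlinarith) (by positivity)
    have h2 : V ≤ Real.exp (-L) := h.trans (Real.exp_le_exp.2 (by
      have : 1 ≤ 2 * x ^ 2 := by nlinarith
      nlinarith))
    have h3 : (x - 3 / 4) * G * V ≤ 1 / 4 * G * Real.exp (-L) := by
      have : x - 3 / 4 ≤ 1 / 4 := by linarith
      gcongr
    linarith
  · have h := hexp x (by nlinarith [mul_nonneg hk (by nlinarith : 0 ≤ x ^ 2 - x)]) (by positivity)
    -- The excess over 3/4 is now unbounded in x; exp L ≥ 4 and the extra decay exp (-2 (x - 1) L)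
    -- absorb the factor 4 x.
    have h4 : Real.exp (-(2 * x * L)) * (4 * x) ≤ Real.exp (-L) := by
      have h5 : 4 * x ≤ Real.exp ((2 * x - 1) * L) := by
        have h6 : Real.exp ((2 * x - 1) * L) = Real.exp L * Real.exp (2 * (x - 1) * L) := by
          rw [← Real.exp_add]; ring_nf
        have h7 : 4 ≤ Real.exp L := by
          rw [← Real.log_le_iff_le_exp (by norm_num)]; exact hL
        have h8 : x ≤ Real.exp (2 * (x - 1) * L) := by
          have := Real.add_one_le_exp (2 * (x - 1) * L)
          nlinarith
        rw [h6]; gcongr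
      calc Real.exp (-(2 * x * L)) * (4 * x)
          ≤ Real.exp (-(2 * x * L)) * Real.exp ((2 * x - 1) * L) := by gcongr
        _ = Real.exp (-L) := by rw [← Real.exp_add]; ring_nf
    have h9 : x * V ≤ 1 / 4 * Real.exp (-L) := by nlinarith
    have : x * G * V ≤ 1 / 4 * G * Real.exp (-L) := by nlinarith
    have : 0 ≤ 3 / 4 * G * V := by positivity
    linarith

/-! ### Positivity, traces and permutations of tensor products -/

open Matrix

set_option linter.unusedSectionVars false

variable {ι : Type*} [Fintype ι] [DecidableEq ι]

open scoped MatrixOrder in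
theorem exists_eq_conjTranspose_mul_self {κ : Type*} [Fintype κ] [DecidableEq κ]
    {A : Matrix κ κ ℂ} (hA : A.PosSemidef) : ∃ B : Matrix κ κ ℂ, A = Bᴴ * B :=
  CStarAlgebra.nonneg_iff_eq_star_mul_self.1 hA.nonneg

theorem tensorOp_mul {m : ℕ} (A B : Fin m → Matrix ι ι ℂ) :
    tensorOp A * tensorOp B = tensorOp fun j => A j * B j := by
  ext x y
  simp only [mul_apply, tensorOp, of_apply]
  rw [Finset.prod_univ_sum]
  simp only [Fintype.piFinset_univ, Finset.prod_mul_distrib]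

theorem tensorOp_one (m : ℕ) : tensorOp (fun _ : Fin m => (1 : Matrix ι ι ℂ)) = 1 := by
  ext x y
  simp only [tensorOp, of_apply, one_apply, Finset.prod_ite_zero, Finset.prod_const_one,
    Finset.mem_univ, forall_true_left, funext_iff]

theorem conjTranspose_tensorOp {m : ℕ} (A : Fin m → Matrix ι ι ℂ) :
    (tensorOp A)ᴴ = tensorOp fun j => (A j)ᴴ := by
  ext x y
  simp [tensorOp, conjTranspose_apply]

theorem posSemidef_tensorOp {m : ℕ} {A : Fin m → Matrix ι ι ℂ} (hA : ∀ j, (A j).PosSemidef) :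
    (tensorOp A).PosSemidef := by
  choose B hB using fun j => exists_eq_conjTranspose_mul_self (hA j)
  rw [show A = fun j => (B j)ᴴ * B j from funext hB, ← tensorOp_mul, ← conjTranspose_tensorOp]
  exact posSemidef_conjTranspose_mul_self _

theorem trace_tensorOp {m : ℕ} (A : Fin m → Matrix ι ι ℂ) :
    (tensorOp A).trace = ∏ j, (A j).trace := by
  have h := trace_tensorOp_mul A fun _ => 1
  simpa [tensorOp_one] using h

theorem trace_mul_nonneg {κ : Type*} [Fintype κ] [DecidableEq κ] {A ρ : Matrix κ κ ℂ}
    (hA : A.PosSemidef) (hρ : ρ.PosSemidef) : 0 ≤ (A * ρ).trace.re := by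
  obtain ⟨B, rfl⟩ := exists_eq_conjTranspose_mul_self hA
  rw [mul_assoc, trace_mul_comm]
  exact (Complex.le_def.1 (hρ.mul_mul_conjTranspose_same B).trace_nonneg).1

theorem posSemidef_proj (ψ : EuclideanSpace ℂ ι) : (proj ψ).PosSemidef := by
  have : proj ψ = vecMulVec (fun a => ψ a) (star fun a => ψ a) := by
    ext a b; simp [proj, vecMulVec_apply]
  rw [this]
  exact posSemidef_vecMulVec_self_star _

theorem posSemidef_one_sub_proj {ψ : EuclideanSpace ℂ ι} (hψ : ‖ψ‖ = 1) :
    (1 - proj ψ).PosSemidef := by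
  have h : (1 - proj ψ) = (1 - proj ψ)ᴴ * (1 - proj ψ) := by
    rw [conjTranspose_sub, conjTranspose_one, (posSemidef_proj ψ).1.eq, Matrix.sub_mul, one_mul,
      Matrix.mul_sub, proj_mul_proj hψ]
    simp
  rw [h]
  exact posSemidef_conjTranspose_mul_self _

theorem trace_tensorOp_comp_mul {m : ℕ} (A : Fin m → Matrix ι ι ℂ)
    {ρ : Matrix (Fin m → ι) (Fin m → ι) ℂ} (hρ : IsPermInvariant ρ) (σ : Equiv.Perm (Fin m)) :
    (tensorOp (fun j => A (σ j)) * ρ).trace = (tensorOp A * ρ).trace := by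
  simp only [trace, diag_apply, mul_apply, tensorOp, of_apply]
  let e : (Fin m → ι) ≃ (Fin m → ι) := Equiv.arrowCongr σ.symm (Equiv.refl ι)
  have he : ∀ x : Fin m → ι, e x = x ∘ σ := fun x => rfl
  rw [← Equiv.sum_comp e]
  refine Finset.sum_congr rfl fun x _ => ?_
  rw [← Equiv.sum_comp e]
  refine Finset.sum_congr rfl fun y _ => ?_
  rw [he, he, hρ σ y x]
  congr 1
  exact Equiv.prod_comp σ fun j => A j (x j) (y j)

/-! ### Configuration weights and generating polynomials -/

/-- The weight of `ρ` on the configuration in which exactly the first `m` factors are orthogonal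
to `ψ`. -/
noncomputable def configWeight {n : ℕ} (ψ : EuclideanSpace ℂ ι)
    (ρ : Matrix (Fin n → ι) (Fin n → ι) ℂ) (m : ℕ) : ℝ :=
  (tensorOp (fun j : Fin n => if (j : ℕ) < m then 1 - proj ψ else proj ψ) * ρ).trace.re

theorem configWeight_nonneg {n : ℕ} {ψ : EuclideanSpace ℂ ι} (hψ : ‖ψ‖ = 1)
    {ρ : Matrix (Fin n → ι) (Fin n → ι) ℂ} (hρ : ρ.PosSemidef) (m : ℕ) :
    0 ≤ configWeight ψ ρ m := by
  refine trace_mul_nonneg (posSemidef_tensorOp fun j => ?_) hρ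
  split_ifs
  exacts [posSemidef_one_sub_proj hψ, posSemidef_proj ψ]

theorem trace_tensorOp_config {n : ℕ} (ψ : EuclideanSpace ℂ ι)
    {ρ : Matrix (Fin n → ι) (Fin n → ι) ℂ} (hρ : IsPermInvariant ρ) (S : Finset (Fin n)) :
    (tensorOp (fun j : Fin n => if j ∈ S then 1 - proj ψ else proj ψ) * ρ).trace.re =
      configWeight ψ ρ S.card := by
  have hcard : S.card = (Finset.univ.filter fun j : Fin n => (j : ℕ) < S.card).card := by
    rw [Fin.card_filter_val_lt]
    exact (min_eq_right (by simpa using S.card_le_univ)).symm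
  obtain ⟨σ, hσ⟩ : ∃ σ : Equiv.Perm (Fin n), ∀ j, (σ j : ℕ) < S.card ↔ j ∈ S := by
    have e : {j // j ∈ S} ≃ {j : Fin n // (j : ℕ) < S.card} :=
      Fintype.equivOfCardEq (by
        rw [Fintype.card_coe, Fintype.card_subtype]; exact hcard)
    refine ⟨e.extendSubtype, fun j => ⟨fun h => ?_, fun h => e.extendSubtype_mem j h⟩⟩
    by_contra hj
    exact e.extendSubtype_not_mem j hj h
  rw [configWeight, ← trace_tensorOp_comp_mul
    (fun j : Fin n => if (j : ℕ) < S.card then 1 - proj ψ else proj ψ) hρ σ]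
  simp only [hσ]

/-- The linear functional on polynomials that sends `X ^ m` to `u m`, for `m ≤ n`. -/
noncomputable def weightFunctional (u : ℕ → ℝ) (n : ℕ) : Polynomial ℝ →ₗ[ℝ] ℝ :=
  ∑ m ∈ Finset.range (n + 1), u m • Polynomial.lcoeff ℝ m

theorem weightFunctional_apply (u : ℕ → ℝ) (n : ℕ) (p : Polynomial ℝ) :
    weightFunctional u n p = ∑ m ∈ Finset.range (n + 1), u m * p.coeff m := by
  simp [weightFunctional]

theorem weightFunctional_monomial (u : ℕ → ℝ) {n m : ℕ} (hm : m ≤ n) (a : ℝ) :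
    weightFunctional u n (Polynomial.C a * Polynomial.X ^ m) = a * u m := by
  rw [weightFunctional_apply, Finset.sum_eq_single_of_mem m (Finset.mem_range.2 (by omega))]
  · rw [Polynomial.coeff_C_mul_X_pow, if_pos rfl, mul_comm]
  · intro i _ hi; rw [Polynomial.coeff_C_mul_X_pow, if_neg hi, mul_zero]

/-- Expanding the tensor product over the set S of orthogonal factors, invariance makes each term
depend only on the size of S, which is the exponent of X. Operator identities thus become identities
of commuting polynomials. -/
theorem trace_tensorOp_eq_weightFunctional {n : ℕ} (ψ : EuclideanSpace ℂ ι)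
    {ρ : Matrix (Fin n → ι) (Fin n → ι) ℂ} (hρ : IsPermInvariant ρ) (c d : Fin n → ℝ) :
    (tensorOp (fun j => (c j : ℂ) • (1 - proj ψ) + (d j : ℂ) • proj ψ) * ρ).trace.re =
      weightFunctional (configWeight ψ ρ) n
        (∏ j, (Polynomial.C (c j) * Polynomial.X + Polynomial.C (d j))) := by
  have hexp : tensorOp (fun j => (c j : ℂ) • (1 - proj ψ) + (d j : ℂ) • proj ψ) =
      ∑ S : Finset (Fin n), (((∏ j ∈ S, c j) * ∏ j ∈ Finset.univ \ S, d j : ℝ) : ℂ) •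
        tensorOp (fun j : Fin n => if j ∈ S then 1 - proj ψ else proj ψ) := by
    ext x y
    simp only [tensorOp, of_apply, Matrix.sum_apply, Matrix.smul_apply, Matrix.add_apply]
    rw [Finset.prod_add, Finset.powerset_univ]
    refine Finset.sum_congr rfl fun S _ => ?_
    have : ∏ j, (if j ∈ S then 1 - proj ψ else proj ψ) (x j) (y j) =
        (∏ j ∈ S, (1 - proj ψ) (x j) (y j)) * ∏ j ∈ Finset.univ \ S, proj ψ (x j) (y j) := by
      rw [← Finset.prod_sdiff (Finset.subset_univ S), mul_comm]
      congr 1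
      · exact Finset.prod_congr rfl fun j hj => by rw [if_pos hj]
      · exact Finset.prod_congr rfl fun j hj => by rw [if_neg (Finset.mem_sdiff.1 hj).2]
    rw [this]
    simp only [smul_eq_mul, Finset.prod_mul_distrib]
    push_cast
    ring
  rw [hexp, Finset.sum_mul, trace_sum, Complex.re_sum, Finset.prod_add, Finset.powerset_univ,
    map_sum]
  refine Finset.sum_congr rfl fun S _ => ?_
  rw [Matrix.smul_mul, trace_smul, smul_eq_mul, Complex.re_ofReal_mul, trace_tensorOp_config ψ hρ]
  have : (∏ j ∈ S, (Polynomial.C (c j) * Polynomial.X)) *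
      ∏ j ∈ Finset.univ \ S, Polynomial.C (d j) =
      Polynomial.C ((∏ j ∈ S, c j) * ∏ j ∈ Finset.univ \ S, d j) * Polynomial.X ^ S.card := by
    rw [Finset.prod_mul_distrib, Finset.prod_const, ← map_prod, ← map_prod, map_mul]
    ring
  rw [this, weightFunctional_monomial _ (by simpa using S.card_le_univ)]

theorem prod_testOp_shape {R : Type*} [CommRing R] (a b t : R) {N i : ℕ} (hi : i ≤ N) :
    ∏ j : Fin (N + 1), (if (j : ℕ) < N - i then a else if (j : ℕ) < N then b else t) =
      a ^ (N - i) * b ^ i * t := by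
  rw [Fin.prod_univ_eq_prod_range
    (fun j => if j < N - i then a else if j < N then b else t) (N + 1), Finset.prod_range_succ,
    ← Finset.prod_range_mul_prod_Ico _ (Nat.sub_le N i)]
  rw [Finset.prod_congr rfl (g := fun _ => a) fun j hj => if_pos (Finset.mem_range.1 hj),
    Finset.prod_congr rfl (s₁ := Finset.Ico (N - i) N) (g := fun _ => b) fun j hj => by
      rw [if_neg (not_lt.2 (Finset.mem_Ico.1 hj).1), if_pos (Finset.mem_Ico.1 hj).2]]
  simp only [Finset.prod_const, Finset.card_range, Nat.card_Ico, Nat.sub_sub_self hi]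
  rw [if_neg (by omega), if_neg (by omega)]

/-- The probability that exactly `z` of `n` tests fail, as a polynomial in the configuration
weights; each factor orthogonal to the target fails with probability `t`. -/
noncomputable def failurePoly (t : ℝ) (n z : ℕ) : Polynomial ℝ :=
  Polynomial.C (n.choose z : ℝ) *
    ((Polynomial.C (1 - t) * Polynomial.X + 1) ^ (n - z) * (Polynomial.C t * Polynomial.X) ^ z)

theorem coeff_linear_pow (a : ℝ) (m j : ℕ) :
    ((Polynomial.C a * Polynomial.X + 1) ^ m).coeff j = m.choose j * a ^ j := by
  have h : (Polynomial.C a * Polynomial.X + 1 : Polynomial ℝ) ^ m =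
      ((Polynomial.X + 1) ^ m).comp (Polynomial.C a * Polynomial.X) := by simp
  rw [h, Polynomial.comp_C_mul_X_coeff, Polynomial.coeff_X_add_one_pow]

theorem coeff_failurePoly (t : ℝ) (n z j : ℕ) :
    (failurePoly t n z).coeff j = n.choose j * binomialMass j z t := by
  rw [failurePoly, mul_pow, ← Polynomial.C_pow, mul_left_comm _ (Polynomial.C (t ^ z)),
    Polynomial.coeff_C_mul, Polynomial.coeff_C_mul, Polynomial.coeff_mul_X_pow', binomialMass]
  split_ifs with h
  · rw [coeff_linear_pow]
    have hc : (n.choose j : ℝ) * j.choose z = n.choose z * (n - z).choose (j - z) := by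
      exact_mod_cast Nat.choose_mul h
    linear_combination (-(t ^ z * (1 - t) ^ (j - z))) * hc
  · simp [Nat.choose_eq_zero_of_lt (not_le.1 h)]

theorem weightFunctional_failurePoly (u : ℕ → ℝ) (t : ℝ) (n z : ℕ) :
    weightFunctional u n (failurePoly t n z) =
      ∑ j ∈ Finset.range (n + 1), n.choose j * u j * binomialMass j z t := by
  rw [weightFunctional_apply]
  exact Finset.sum_congr rfl fun j _ => by rw [coeff_failurePoly]; ring

theorem sum_choose_mul_configWeight {n : ℕ} (ψ : EuclideanSpace ℂ ι)
    {ρ : Matrix (Fin n → ι) (Fin n → ι) ℂ} (hρ : IsPermInvariant ρ) (htr : ρ.trace = 1) :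
    ∑ j ∈ Finset.range (n + 1), n.choose j * configWeight ψ ρ j = 1 := by
  have h := trace_tensorOp_eq_weightFunctional ψ hρ (fun _ => 1) (fun _ => 1)
  simp only [Complex.ofReal_one, one_smul, sub_add_cancel, tensorOp_one, one_mul, htr,
    Complex.one_re, map_one, Finset.prod_const, Finset.card_univ, Fintype.card_fin] at h
  rw [h, weightFunctional_apply]
  exact Finset.sum_congr rfl fun j _ => by rw [Polynomial.coeff_X_add_one_pow, mul_comm]

/-- The case c = d = 1 leaves the last factor free; c = 0, d = 1 projects it on `ψ`. -/
theorem acceptWith_eq_weightFunctional (ψ : EuclideanSpace ℂ ι) (lam : ℝ) {k N : ℕ} (hk : k ≤ N)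
    {ρ : Matrix (Fin (N + 1) → ι) (Fin (N + 1) → ι) ℂ} (hρ : IsPermInvariant ρ) (c d : ℝ) :
    acceptWith ψ lam k N ((c : ℂ) • (1 - proj ψ) + (d : ℂ) • proj ψ) ρ =
      weightFunctional (configWeight ψ ρ) (N + 1)
        (∑ i ∈ Finset.range (k + 1), Polynomial.C (N.choose i : ℝ) *
          ((Polynomial.C lam * Polynomial.X + 1) ^ (N - i) *
            (Polynomial.C (1 - lam) * Polynomial.X) ^ i *
            (Polynomial.C c * Polynomial.X + Polynomial.C d))) := by
  rw [acceptWith, map_sum]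
  refine Finset.sum_congr rfl fun i hi => ?_
  have hiN : i ≤ N := (Nat.lt_succ_iff.1 (Finset.mem_range.1 hi)).trans hk
  rw [← Polynomial.smul_eq_C_mul, map_smul, smul_eq_mul]
  congr 1
  let cs : Fin (N + 1) → ℝ := fun j =>
    if (j : ℕ) < N - i then lam else if (j : ℕ) < N then 1 - lam else c
  let ds : Fin (N + 1) → ℝ := fun j =>
    if (j : ℕ) < N - i then 1 else if (j : ℕ) < N then 0 else d
  have hop : testOp (strategy ψ lam) ((c : ℂ) • (1 - proj ψ) + (d : ℂ) • proj ψ) N i =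
      tensorOp (fun j => (cs j : ℂ) • (1 - proj ψ) + (ds j : ℂ) • proj ψ) := by
    rw [testOp]
    congr 1
    ext1 j
    simp only [cs, ds, strategy]
    split_ifs
    · simp [add_comm]
    · push_cast
      module
    · rfl
  rw [hop, trace_tensorOp_eq_weightFunctional ψ hρ, ← prod_testOp_shape _ _ _ hiN]
  congr 1
  refine Finset.prod_congr rfl fun j _ => ?_
  simp only [cs, ds]
  split_ifs <;> simp

/-- With a for passing and b for failing: at most k failures in N tests means at most k in N + 1
tests, or exactly k in the first N and a failure in the last. -/
theorem sum_pascal {R : Type*} [CommRing R] (a b : R) {k N : ℕ} (hk : k ≤ N) :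
    ∑ i ∈ Finset.range (k + 1), (N.choose i : R) * (a ^ (N - i) * b ^ i * (a + b)) =
      ∑ i ∈ Finset.range (k + 1), ((N + 1).choose i : R) * (a ^ (N + 1 - i) * b ^ i) +
        N.choose k * (a ^ (N - k) * b ^ (k + 1)) := by
  induction k with
  | zero => simp; ring
  | succ k ih =>
    rw [Finset.sum_range_succ, ih (by omega), Finset.sum_range_succ _ (k + 1), Nat.choose_succ_succ]
    obtain ⟨d, rfl⟩ := Nat.exists_eq_add_of_le hk
    rw [show k + 1 + d - k = d + 1 by omega, show k + 1 + d - (k + 1) = d by omega,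
      show k + 1 + d + 1 - (k + 1) = d + 1 by omega]
    push_cast
    ring

/-- The acceptance probability and the probability of acceptance with an orthogonal last factor,
compared with a mixture of binomial distributions. -/
theorem exists_binomial_mixture {ψ : EuclideanSpace ℂ ι} (hψ : ‖ψ‖ = 1) {t : ℝ} (ht0 : 0 < t)
    (ht1 : t < 1) {k N : ℕ} (hk : k ≤ N) {ρ : Matrix (Fin (N + 1) → ι) (Fin (N + 1) → ι) ℂ}
    (hρ : IsDensity ρ) (hinv : IsPermInvariant ρ) :
    ∃ q : ℕ → ℝ, (∀ j, 0 ≤ q j) ∧ ∑ j ∈ Finset.range (N + 2), q j = 1 ∧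
      ∑ j ∈ Finset.range (N + 2), q j * binomialTail j k t ≤ acceptProb ψ (1 - t) k N ρ ∧
      t * (N + 1) * (acceptProb ψ (1 - t) k N ρ - acceptWith ψ (1 - t) k N (proj ψ) ρ) ≤
        k * ∑ j ∈ Finset.range (N + 2), q j * binomialTail j k t +
          ∑ j ∈ Finset.range (N + 2), q j * ((k + 1) * binomialMass j (k + 1) t) := by
  set u := configWeight ψ ρ
  set F := weightFunctional u (N + 1)
  have hu : ∀ j, 0 ≤ u j := configWeight_nonneg hψ hρ.1
  set w : ℕ → ℝ := fun z => F (failurePoly t (N + 1) z)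
  have hw : ∀ z, w z = ∑ j ∈ Finset.range (N + 2), (N + 1).choose j * u j * binomialMass j z t :=
    weightFunctional_failurePoly u t (N + 1)
  have hw0 : ∀ z, 0 ≤ w z := fun z => by
    rw [hw]
    exact Finset.sum_nonneg fun j _ => mul_nonneg (mul_nonneg (Nat.cast_nonneg _) (hu j))
      (binomialMass_nonneg j z ht0.le ht1.le)
  have hN : (0 : ℝ) < N + 1 := by positivity
  -- Exchangeability: given i + 1 failures among N + 1 tests, the last test is one of them with
  -- probability (i + 1) / (N + 1).
  have hshift : ∀ i, ((N : ℝ) + 1) * F (Polynomial.C (N.choose i : ℝ) *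
      ((Polynomial.C (1 - t) * Polynomial.X + 1) ^ (N - i) *
        (Polynomial.C t * Polynomial.X) ^ (i + 1))) = (i + 1) * w (i + 1) := by
    intro i
    have hc : ((N : ℝ) + 1) * N.choose i = (i + 1) * (N + 1).choose (i + 1) := by
      have := Nat.add_one_mul_choose_eq N i
      rw [mul_comm ((i : ℝ) + 1)]
      exact_mod_cast this
    simp only [w, failurePoly, ← Polynomial.smul_eq_C_mul, map_smul, smul_eq_mul]
    rw [← mul_assoc, hc, Nat.add_sub_add_right]
    ring
  have hW : ∑ j ∈ Finset.range (N + 2), (N + 1).choose j * u j * binomialTail j k t =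
      ∑ z ∈ Finset.range (k + 1), w z := by
    simp only [hw, binomialTail, Finset.mul_sum]
    rw [Finset.sum_comm]
  have hR : ∑ j ∈ Finset.range (N + 2),
      (N + 1).choose j * u j * ((k + 1) * binomialMass j (k + 1) t) = (k + 1) * w (k + 1) := by
    rw [hw, Finset.mul_sum]
    exact Finset.sum_congr rfl fun j _ => by ring
  refine ⟨fun j => (N + 1).choose j * u j, fun j => mul_nonneg (Nat.cast_nonneg _) (hu j),
    sum_choose_mul_configWeight ψ hinv hρ.2, ?_, ?_⟩
  · rw [hW]
    have h := acceptWith_eq_weightFunctional ψ (1 - t) hk hinv 1 1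
    rw [Complex.ofReal_one, one_smul, one_smul, sub_add_cancel] at h
    rw [acceptProb, h]
    have hpoly := sum_pascal (Polynomial.C (1 - t) * Polynomial.X + 1 : Polynomial ℝ)
      (Polynomial.C t * Polynomial.X) hk
    have hone : (Polynomial.C (1 - t) * Polynomial.X + 1 + Polynomial.C t * Polynomial.X :
        Polynomial ℝ) = Polynomial.C 1 * Polynomial.X + Polynomial.C 1 := by
      simp only [map_sub, map_one]; ring
    rw [hone] at hpoly
    simp only [sub_sub_cancel]
    simp only [← Polynomial.C_eq_natCast] at hpoly
    rw [hpoly, map_add, map_sum]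
    have h2 := hshift k
    have h3 := hw0 (k + 1)
    have : 0 ≤ F (Polynomial.C (N.choose k : ℝ) *
      ((Polynomial.C (1 - t) * Polynomial.X + 1) ^ (N - k) *
        (Polynomial.C t * Polynomial.X) ^ (k + 1))) := by
      refine nonneg_of_mul_nonneg_right (a := (N : ℝ) + 1) ?_ hN
      rw [h2]; positivity
    exact le_add_of_nonneg_right this
  · rw [hW, hR]
    have h1 := acceptWith_eq_weightFunctional ψ (1 - t) hk hinv 1 1
    have h2 := acceptWith_eq_weightFunctional ψ (1 - t) hk hinv 0 1
    rw [Complex.ofReal_one, one_smul, one_smul, sub_add_cancel] at h1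
    rw [Complex.ofReal_one, Complex.ofReal_zero, one_smul, zero_smul, zero_add] at h2
    rw [acceptProb, h1, h2, ← map_sub, ← Finset.sum_sub_distrib, map_sum, Finset.mul_sum]
    have hterm : ∀ i ∈ Finset.range (k + 1), t * ((N : ℝ) + 1) * F (
        Polynomial.C (N.choose i : ℝ) *
          ((Polynomial.C (1 - t) * Polynomial.X + 1) ^ (N - i) *
            (Polynomial.C (1 - (1 - t)) * Polynomial.X) ^ i *
            (Polynomial.C 1 * Polynomial.X + Polynomial.C 1)) -
        Polynomial.C (N.choose i : ℝ) *
          ((Polynomial.C (1 - t) * Polynomial.X + 1) ^ (N - i) *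
            (Polynomial.C (1 - (1 - t)) * Polynomial.X) ^ i *
            (Polynomial.C 0 * Polynomial.X + Polynomial.C 1))) = (i + 1) * w (i + 1) := by
      intro i _
      rw [← hshift i, mul_comm t, mul_assoc]
      congr 1
      rw [← smul_eq_mul, ← map_smul, Polynomial.smul_eq_C_mul]
      congr 1
      rw [sub_sub_cancel, Polynomial.C_0, Polynomial.C_1]
      ring
    rw [Finset.sum_congr rfl hterm, Finset.sum_range_succ]
    refine add_le_add_left ?_ _
    have hz : ∑ i ∈ Finset.range k, ((i : ℝ) + 1) * w (i + 1) =
        ∑ z ∈ Finset.range (k + 1), (z : ℝ) * w z := by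
      rw [Finset.sum_range_succ' _ k]; simp
    rw [hz, Finset.mul_sum]
    refine Finset.sum_le_sum fun z hzk => mul_le_mul_of_nonneg_right ?_ (hw0 z)
    exact_mod_cast Nat.lt_succ_iff.1 (Finset.mem_range.1 hzk)

/-! ### Upper bound on the guaranteed infidelity -/

theorem guaranteedInfidelity_le {ψ : EuclideanSpace ℂ ι} (hψ : ‖ψ‖ = 1) {lam ε δ : ℝ}
    (hlam0 : 0 < lam) (hlam1 : lam < 1) (hε0 : 0 < ε) (hε1 : ε < 1) (hδ0 : 0 < δ)
    (hδ1 : δ ≤ 1 / 4) {N k : ℕ} (hk : (k : ℤ) ≤ failureBound lam N ε δ) :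
    guaranteedInfidelity ψ lam k N δ ≤ ε := by
  obtain ⟨⟨ρ, ⟨hρ, hinv, hδρ⟩, hF⟩, -⟩ :=
    isLeast_condFidelity hψ lam k N hδ0 (by linarith : δ ≤ 1)
  have hk' := Int.le_floor.1 hk
  rw [Int.cast_natCast] at hk'
  obtain ⟨t, rfl⟩ : ∃ t, lam = 1 - t := ⟨1 - lam, by ring⟩
  have ht0 : 0 < t := by linarith
  have ht1 : t < 1 := by linarith
  rw [sub_sub_cancel] at hk'
  set L := Real.log δ⁻¹ with hLdef
  have hL4 : Real.log 4 ≤ L := by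
    refine Real.log_le_log (by norm_num) ?_
    rw [le_inv_comm₀ (by norm_num) hδ0]; linarith
  have hL0 : 0 < L := (Real.log_pos (by norm_num)).trans_le hL4
  have hexp : Real.exp (-L) = δ := by
    rw [hLdef, Real.log_inv, neg_neg, Real.exp_log hδ0]
  have hN0 : (0 : ℝ) ≤ N := N.cast_nonneg
  have hk0 : (0 : ℝ) ≤ k := k.cast_nonneg
  set S := Real.sqrt (N * ε * L) with hS
  have hS0 : 0 ≤ S := Real.sqrt_nonneg _
  have hS2 : S ^ 2 = N * ε * L := Real.sq_sqrt (by positivity)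
  set G := t * ε * N - k with hG
  -- The last two terms of the bound enter only through their sign; the square-root term gives the
  -- required lower bound on G.
  have hrest1 : 0 < L / (2 * (1 - t) * t) := by positivity
  have hrest2 : 0 < 2 * t / (1 - t) := by positivity
  have hGS : S / (1 - t) ≤ G := by linarith
  have hGpos : 0 < G := by
    have : 0 ≤ S / (1 - t) := by positivity
    linarith
  have hkN : k ≤ N := by
    have h1 : t * ε ≤ 1 := by nlinarith
    have : t * ε * N ≤ 1 * N := by gcongr
    have : (k : ℝ) ≤ N := by linarith
    exact_mod_cast this
  have hGL : ε * N * L ≤ ((1 - t) * G) ^ 2 := by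
    rw [div_le_iff₀ hlam0] at hGS
    calc ε * N * L = S ^ 2 := by rw [hS2]; ring
      _ ≤ ((1 - t) * G) ^ 2 := by
        refine pow_le_pow_left₀ hS0 ?_ 2
        linarith
  obtain ⟨q, hq0, hq1, hqW, hqB⟩ := exists_binomial_mixture hψ ht0 ht1 hkN hρ hinv
  set p := acceptProb ψ (1 - t) k N ρ
  set W := ∑ j ∈ Finset.range (N + 2), q j * binomialTail j k t
  have hp : 0 < p := hδ0.trans_le hδρ
  have hR : ∑ j ∈ Finset.range (N + 2), q j * ((k + 1) * binomialMass j (k + 1) t) ≤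
      3 / 4 * G * W + 1 / 4 * G * δ := by
    calc _ ≤ ∑ j ∈ Finset.range (N + 2),
          q j * (3 / 4 * G * binomialTail j k t + 1 / 4 * G * δ) := by
          refine Finset.sum_le_sum fun j _ => mul_le_mul_of_nonneg_left ?_ (hq0 j)
          have := binomialMass_succ_le j k (M := ε * N) ht0 ht1 hGpos (by rw [hG]; ring) hL4 hGL
          rwa [hexp] at this
      _ = 3 / 4 * G * W + 1 / 4 * G * δ * ∑ j ∈ Finset.range (N + 2), q j := by
          rw [Finset.mul_sum, Finset.mul_sum, ← Finset.sum_add_distrib]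
          exact Finset.sum_congr rfl fun j _ => by ring
      _ = _ := by rw [hq1, mul_one]
  -- By W ≤ p and δ ≤ p the costs add up to k p + 3/4 G p + 1/4 G p = t ε N p, within t (N + 1) ε p.
  have hB : p - acceptWith ψ (1 - t) k N (proj ψ) ρ ≤ ε * p := by
    have h1 : t * ((N : ℝ) + 1) * (p - acceptWith ψ (1 - t) k N (proj ψ) ρ) ≤
        t * ((N : ℝ) + 1) * (ε * p) := by
      have h2 : (k : ℝ) * W ≤ k * p := by gcongr
      have h3 : 3 / 4 * G * W ≤ 3 / 4 * G * p := by gcongr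
      have h4 : 1 / 4 * G * δ ≤ 1 / 4 * G * p := by gcongr
      have h5 : (k + G) * p = t * ε * N * p := by rw [hG]; ring
      have h6 : 0 ≤ t * ε * p := by positivity
      linarith
    exact le_of_mul_le_mul_left h1 (by positivity)
  have : 1 - ε ≤ condFidelity ψ (1 - t) k N ρ := by
    rw [condFidelity, le_div_iff₀ hp]
    linarith
  linarith

/-! ### Median of the binomial distribution -/

theorem sum_binomialMass (N : ℕ) (s : ℝ) :
    ∑ i ∈ Finset.range (N + 1), binomialMass N i s = 1 := by
  have h := add_pow s (1 - s) N
  rw [add_sub_cancel, one_pow] at h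
  rw [h]
  exact Finset.sum_congr rfl fun i _ => by unfold binomialMass; ring

/-- At success probability k / (k + n) this compares the masses at k + 1 + i and k - i, cleared of
denominators. The inductive step compares ratios of neighbouring masses. -/
theorem choose_mul_pow_le {k n : ℕ} (hnk : n ≤ k) {i : ℕ} (hi : i < n) :
    (k + n).choose (k + 1 + i) * k ^ (2 * i + 1) ≤ (k + n).choose (k - i) * n ^ (2 * i + 1) := by
  induction i with
  | zero =>
    have h := Nat.choose_succ_right_eq (k + n) k
    rw [Nat.add_sub_cancel_left] at h
    simp only [add_zero, mul_zero, zero_add, pow_one, Nat.sub_zero]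
    rw [← h]
    gcongr
    exact Nat.le_succ k
  | succ i ih =>
    have ih := ih (by omega)
    have h1 := Nat.choose_succ_right_eq (k + n) (k + 1 + i)
    have h2 := Nat.choose_succ_right_eq (k + n) (k - (i + 1))
    rw [show k - (i + 1) + 1 = k - i by omega] at h2
    obtain ⟨a, rfl⟩ : ∃ a, n = i + 2 + a := ⟨n - (i + 2), by omega⟩
    obtain ⟨b, rfl⟩ : ∃ b, k = i + 2 + a + b := ⟨k - (i + 2 + a), by omega⟩
    rw [show i + 2 + a + b + (i + 2 + a) - (i + 2 + a + b + 1 + i) = a + 1 by omega] at h1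
    rw [show i + 2 + a + b + (i + 2 + a) - (i + 2 + a + b - (i + 1)) = i + 2 + a + i + 1 by omega,
      ] at h2
    rw [show i + 2 + a + b + 1 + (i + 1) = i + 2 + a + b + 1 + i + 1 by ring]
    rw [show i + 2 + a + b - i = 2 + a + b by omega] at ih h2
    set A := (i + 2 + a + b + (i + 2 + a)).choose (i + 2 + a + b + 1 + i + 1)
    set A' := (i + 2 + a + b + (i + 2 + a)).choose (i + 2 + a + b + 1 + i)
    set B := (i + 2 + a + b + (i + 2 + a)).choose (i + 2 + a + b - (i + 1))
    set B' := (i + 2 + a + b + (i + 2 + a)).choose (2 + a + b)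
    -- In the original variables: (n ^ 2 - (i + 1) ^ 2) k ^ 2 ≤ ((k + 1) ^ 2 - (i + 1) ^ 2) n ^ 2.
    have hpoly : (a + 1) * (i + 2 + a + i + 1) * (i + 2 + a + b) ^ 2 ≤
        (2 + a + b) * (i + 2 + a + b + 1 + i + 1) * (i + 2 + a) ^ 2 :=
      Nat.le.intro (k := (i + 2 + a) ^ 2 * (2 * (i + 2 + a + b) + 1) +
        (i + 1) ^ 2 * (b ^ 2 + 2 * (i + 2 + a) * b)) (by ring)
    refine le_of_mul_le_mul_right ?_
      (show 0 < (i + 2 + a + b + 1 + i + 1) * (i + 2 + a + i + 1) by positivity)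
    calc A * (i + 2 + a + b) ^ (2 * (i + 1) + 1) *
          ((i + 2 + a + b + 1 + i + 1) * (i + 2 + a + i + 1))
        = A * (i + 2 + a + b + 1 + i + 1) * (i + 2 + a + b) ^ (2 * i + 1) *
          ((i + 2 + a + i + 1) * (i + 2 + a + b) ^ 2) := by ring
      _ = A' * (i + 2 + a + b) ^ (2 * i + 1) *
          ((a + 1) * (i + 2 + a + i + 1) * (i + 2 + a + b) ^ 2) := by rw [h1]; ring
      _ ≤ B' * (i + 2 + a) ^ (2 * i + 1) *
          ((2 + a + b) * (i + 2 + a + b + 1 + i + 1) * (i + 2 + a) ^ 2) :=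
          Nat.mul_le_mul ih hpoly
      _ = B' * (2 + a + b) * (i + 2 + a) ^ (2 * i + 1) *
          ((i + 2 + a + b + 1 + i + 1) * (i + 2 + a) ^ 2) := by ring
      _ = _ := by rw [h2]; ring

/-- Reflection i ↦ 2 k + 1 - i sends the masses above k injectively to larger masses at or below k,
so the upper part is at most half. -/
theorem half_le_binomialTail_of_le {k n : ℕ} (hn : 0 < n) (hnk : n ≤ k) :
    1 / 2 ≤ binomialTail (k + n) k (k / (k + n)) := by
  set s : ℝ := k / (k + n) with hs
  have hn' : (0 : ℝ) < n := by exact_mod_cast hn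
  have hk' : (0 : ℝ) < k := by exact_mod_cast hn.trans_le hnk
  have hs0 : 0 ≤ s := by positivity
  have hs1 : 1 - s = n / (k + n) := by rw [hs]; field_simp; ring
  have hs1' : s ≤ 1 := by
    have : 0 ≤ 1 - s := by rw [hs1]; positivity
    linarith
  have hterm : ∀ i ∈ Finset.range n,
      binomialMass (k + n) (k + 1 + i) s ≤ binomialMass (k + n) (k - i) s := by
    intro i hi
    have hin := Finset.mem_range.1 hi
    have h : ((k + n).choose (k + 1 + i) : ℝ) * k ^ (2 * i + 1) ≤
        (k + n).choose (k - i) * n ^ (2 * i + 1) := by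
      exact_mod_cast choose_mul_pow_le hnk hin
    unfold binomialMass
    rw [hs1, show k + n - (k + 1 + i) = n - 1 - i by omega,
      show k + n - (k - i) = n - 1 - i + (2 * i + 1) by omega,
      show k + 1 + i = k - i + (2 * i + 1) by omega, pow_add _ (k - i) (2 * i + 1),
      pow_add _ (n - 1 - i) (2 * i + 1), hs, div_pow (k : ℝ) _ (2 * i + 1),
      div_pow (n : ℝ) _ (2 * i + 1)]
    rw [show k + 1 + i = k - i + (2 * i + 1) by omega] at h
    have hc : 0 ≤ ((k : ℝ) / (k + n)) ^ (k - i) * (n / (k + n)) ^ (n - 1 - i) /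
        (k + n) ^ (2 * i + 1) := by positivity
    have := mul_le_mul_of_nonneg_right h hc
    refine le_of_eq_of_le ?_ (this.trans_eq ?_) <;> ring
  have htot := sum_binomialMass (k + n) s
  rw [show k + n + 1 = k + 1 + n by ring, Finset.sum_range_add] at htot
  have h1 := Finset.sum_le_sum hterm
  have h2 : ∑ i ∈ Finset.range n, binomialMass (k + n) (k - i) s ≤ binomialTail (k + n) k s := by
    have hreflect := Finset.sum_range_reflect (fun i => binomialMass (k + n) i s) (k + 1)
    simp only [Nat.add_sub_cancel] at hreflect
    rw [binomialTail, ← hreflect]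
    exact Finset.sum_le_sum_of_subset_of_nonneg (Finset.range_mono (by omega))
      fun i _ _ => binomialMass_nonneg _ _ hs0 hs1'
  change binomialTail (k + n) k s + _ = 1 at htot
  linarith

/-- After logarithms: a log ((a + y) / (a - y)) decreases in a, because every term of its power
series in y / a does. -/
theorem pow_mul_pow_reflect_le {k n : ℕ} (hk : 0 < k) (hkn : k ≤ n) {y : ℝ} (hy0 : 0 ≤ y)
    (hy : y < k) :
    ((k : ℝ) - y) ^ k * (n + y) ^ n ≤ (k + y) ^ k * (n - y) ^ n := by
  have hk' : (0 : ℝ) < k := by exact_mod_cast hk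
  have hkn' : (k : ℝ) ≤ n := by exact_mod_cast hkn
  have hn' : (0 : ℝ) < n := hk'.trans_le hkn'
  have hlog : ∀ a : ℝ, 0 < a → y < a → HasSum
      (fun i : ℕ => a * (2 * (1 / (2 * i + 1)) * (y / a) ^ (2 * i + 1)))
      (a * (Real.log (a + y) - Real.log (a - y))) := by
    intro a ha hya
    have habs : |y / a| < 1 := by
      rw [abs_of_nonneg (by positivity), div_lt_one ha]; exact hya
    have h := (Real.hasSum_log_sub_log_of_abs_lt_one habs).mul_left a
    rwa [show 1 + y / a = (a + y) / a by field_simp, show 1 - y / a = (a - y) / a by field_simp,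
      Real.log_div (by linarith) ha.ne', Real.log_div (by linarith) ha.ne',
      sub_sub_sub_cancel_right] at h
  have hle := hasSum_le (fun i => ?_) (hlog n hn' (by linarith)) (hlog k hk' hy)
  · rw [← Real.log_le_log_iff (by have : 0 < (k : ℝ) - y := by linarith
                                  positivity)
      (by have : 0 < (n : ℝ) - y := by linarith
          positivity),
      Real.log_mul (pow_ne_zero _ (by linarith)) (pow_ne_zero _ (by linarith)),
      Real.log_mul (pow_ne_zero _ (by linarith)) (pow_ne_zero _ (by linarith)),
      Real.log_pow, Real.log_pow, Real.log_pow, Real.log_pow]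
    linarith
  · have h : ∀ a : ℝ, 0 < a → a * (2 * (1 / (2 * (i : ℝ) + 1)) * (y / a) ^ (2 * i + 1)) =
        2 * (1 / (2 * (i : ℝ) + 1)) * y * (y / a) ^ (2 * i) := by
      intro a ha
      rw [pow_succ]; field_simp
    rw [h _ hn', h _ hk']
    gcongr

/-- Termwise reflection of masses is replaced by reflection of the parameter about k / N: V ((k - y)
/ N) + V ((k + y) / N) decreases from 2 V (k / N) at y = 0 to at least V 0 = 1 at y = k. -/
theorem half_le_binomialTail_of_ge {k n : ℕ} (hk : 0 < k) (hkn : k ≤ n) :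
    1 / 2 ≤ binomialTail (k + n) k (k / (k + n)) := by
  have hk' : (0 : ℝ) < k := by exact_mod_cast hk
  have hkn' : (k : ℝ) ≤ n := by exact_mod_cast hkn
  have hn' : (0 : ℝ) < n := hk'.trans_le hkn'
  set V := binomialTail (k + n) k
  set N : ℝ := k + n with hN
  have hN0 : 0 < N := by positivity
  set g : ℝ → ℝ := fun s =>
    ((k : ℝ) + 1) * (k + n).choose (k + 1) * s ^ k * (1 - s) ^ (k + n - (k + 1))
  have hV : ∀ s, HasDerivAt V (-g s) s := hasDerivAt_binomialTail (k + n) k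
  have hF : ∀ y : ℝ, HasDerivAt (fun y => V ((k - y) / N) + V ((k + y) / N))
      ((g ((k - y) / N) - g ((k + y) / N)) / N) y := by
    intro y
    have h1 : HasDerivAt (fun y : ℝ => ((k : ℝ) - y) / N) (-1 / N) y :=
      ((hasDerivAt_id y).const_sub (k : ℝ)).div_const N
    have h2 : HasDerivAt (fun y : ℝ => ((k : ℝ) + y) / N) (1 / N) y :=
      ((hasDerivAt_id y).const_add (k : ℝ)).div_const N
    have h := ((hV _).comp y h1).add ((hV _).comp y h2)
    refine h.congr_deriv ?_
    ring
  have hanti : AntitoneOn (fun y => V ((k - y) / N) + V ((k + y) / N)) (Set.Icc 0 (k : ℝ)) := by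
    refine antitoneOn_of_deriv_nonpos (convex_Icc 0 _)
      (fun y _ => (hF y).continuousAt.continuousWithinAt)
      (fun y _ => (hF y).differentiableAt.differentiableWithinAt) ?_
    intro y hy
    rw [interior_Icc] at hy
    rw [(hF y).deriv]
    refine div_nonpos_of_nonpos_of_nonneg (sub_nonpos.2 ?_) hN0.le
    obtain ⟨m, rfl⟩ : ∃ m, n = m + 1 := ⟨n - 1, by omega⟩
    have hrefl := pow_mul_pow_reflect_le hk hkn hy.1.le hy.2
    have hny : (0 : ℝ) < (m + 1 : ℕ) - y := by linarith [hy.2]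
    have hky : (0 : ℝ) < k - y := by linarith [hy.2]
    have hy0 := hy.1
    -- The density carries the exponent n - 1 rather than n; dividing by n - y ≤ n + y keeps the
    -- inequality.
    have hmain : ((k : ℝ) - y) ^ k * ((m + 1 : ℕ) + y) ^ m ≤
        (k + y) ^ k * ((m + 1 : ℕ) - y) ^ m := by
      refine le_of_mul_le_mul_right ?_ hny
      calc ((k : ℝ) - y) ^ k * ((m + 1 : ℕ) + y) ^ m * ((m + 1 : ℕ) - y)
          ≤ ((k : ℝ) - y) ^ k * ((m + 1 : ℕ) + y) ^ m * ((m + 1 : ℕ) + y) := by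
            gcongr; linarith
        _ = ((k : ℝ) - y) ^ k * ((m + 1 : ℕ) + y) ^ (m + 1) := by ring
        _ ≤ (k + y) ^ k * ((m + 1 : ℕ) - y) ^ (m + 1) := hrefl
        _ = _ := by ring
    have e1 : 1 - ((k : ℝ) - y) / N = ((m + 1 : ℕ) + y) / N := by rw [hN]; field_simp; ring
    have e2 : 1 - ((k : ℝ) + y) / N = ((m + 1 : ℕ) - y) / N := by rw [hN]; field_simp; ring
    simp only [g]
    rw [e1, e2, show k + (m + 1) - (k + 1) = m by omega, div_pow, div_pow, div_pow, div_pow]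
    have hc : 0 ≤ ((k : ℝ) + 1) * (k + (m + 1)).choose (k + 1) / (N ^ k * N ^ m) := by positivity
    have := mul_le_mul_of_nonneg_left hmain hc
    convert this using 1 <;> field_simp
  have h := hanti ⟨le_rfl, hk'.le⟩ ⟨hk'.le, le_rfl⟩ hk'.le
  simp only [sub_self, zero_div, sub_zero, add_zero] at h
  have h0 : V 0 = 1 := binomialTail_zero _ _
  have h2 : 0 ≤ V ((k + k) / N) := by
    refine binomialTail_nonneg _ _ (by positivity) ?_
    rw [div_le_one hN0]; linarith
  linarith

/-- A median of the binomial distribution is at most any integer upper bound on the mean. -/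
theorem half_le_binomialTail {N k : ℕ} (hkN : k < N) {s : ℝ} (hs0 : 0 < s)
    (hs : N * s ≤ k) : 1 / 2 ≤ binomialTail N k s := by
  obtain ⟨n, rfl⟩ := Nat.exists_eq_add_of_lt hkN
  rw [show k + n + 1 = k + (n + 1) by ring] at hs ⊢
  push_cast at hs
  have hk : 0 < k := by
    have : (0 : ℝ) < k := lt_of_lt_of_le (by positivity) hs
    exact_mod_cast this
  have hmain : 1 / 2 ≤ binomialTail (k + (n + 1)) k (k / (k + (n + 1 : ℕ))) := by
    rcases le_total k (n + 1) with h | h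
    exacts [half_le_binomialTail_of_ge hk h, half_le_binomialTail_of_le n.succ_pos h]
  have hle : s ≤ k / (k + (n + 1 : ℕ)) := by
    rw [le_div_iff₀ (by positivity)]; push_cast; linarith
  have hle1 : (k : ℝ) / (k + (n + 1 : ℕ)) ≤ 1 := by
    rw [div_le_one (by positivity)]; push_cast; linarith
  exact hmain.trans (antitoneOn_binomialTail _ _ ⟨hs0.le, hle.trans hle1⟩
    ⟨hs0.le.trans hle, hle1⟩ hle)

/-! ### Isotropic product states and the lower bound -/

/-- The state with fidelity `1 - θ` that is isotropic on the complement of `ψ`. -/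
noncomputable def isotropicState (ψ : EuclideanSpace ℂ ι) (θ : ℝ) : Matrix ι ι ℂ :=
  ((1 - θ : ℝ) : ℂ) • proj ψ + ((θ / ((Fintype.card ι : ℝ) - 1) : ℝ) : ℂ) • (1 - proj ψ)

theorem trace_one_sub_proj {ψ : EuclideanSpace ℂ ι} (hψ : ‖ψ‖ = 1) :
    (1 - proj ψ).trace = ((Fintype.card ι : ℝ) - 1 : ℝ) := by
  rw [trace_sub, trace_one, trace_proj hψ]; simp

theorem proj_mul_isotropicState {ψ : EuclideanSpace ℂ ι} (hψ : ‖ψ‖ = 1) (θ : ℝ) :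
    proj ψ * isotropicState ψ θ = ((1 - θ : ℝ) : ℂ) • proj ψ := by
  rw [isotropicState, Matrix.mul_add, Matrix.mul_smul, Matrix.mul_smul, Matrix.mul_sub,
    proj_mul_proj hψ, mul_one, sub_self, smul_zero, add_zero]

theorem trace_isotropicState [Nontrivial ι] {ψ : EuclideanSpace ℂ ι} (hψ : ‖ψ‖ = 1) (θ : ℝ) :
    (isotropicState ψ θ).trace = 1 := by
  have hd : (Fintype.card ι : ℝ) - 1 ≠ 0 := by
    have : (1 : ℝ) < Fintype.card ι := by exact_mod_cast Fintype.one_lt_card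
    linarith
  rw [isotropicState, trace_add, trace_smul, trace_smul, trace_proj hψ, trace_one_sub_proj hψ,
    smul_eq_mul, smul_eq_mul, mul_one, ← Complex.ofReal_mul, div_mul_cancel₀ _ hd,
    ← Complex.ofReal_add]
  simp

theorem posSemidef_isotropicState [Nontrivial ι] {ψ : EuclideanSpace ℂ ι} (hψ : ‖ψ‖ = 1) {θ : ℝ}
    (h0 : 0 ≤ θ) (h1 : θ ≤ 1) : (isotropicState ψ θ).PosSemidef := by
  have hd : 0 < (Fintype.card ι : ℝ) - 1 := by
    have : (1 : ℝ) < Fintype.card ι := by exact_mod_cast Fintype.one_lt_card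
    linarith
  refine ((posSemidef_proj ψ).smul ?_).add ((posSemidef_one_sub_proj hψ).smul ?_)
  · exact Complex.zero_le_real.2 (by linarith)
  · exact Complex.zero_le_real.2 (by positivity)

theorem acceptWith_isotropicState [Nontrivial ι] {ψ : EuclideanSpace ℂ ι} (hψ : ‖ψ‖ = 1)
    (lam θ τ : ℝ) {k N : ℕ} (hk : k ≤ N) (T : Matrix ι ι ℂ)
    (hT : (T * isotropicState ψ θ).trace = τ) :
    acceptWith ψ lam k N T (tensorOp fun _ => isotropicState ψ θ) =
      τ * binomialTail N k ((1 - lam) * θ) := by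
  have hΩ : (strategy ψ lam * isotropicState ψ θ).trace = ((1 - (1 - lam) * θ : ℝ) : ℂ) := by
    rw [strategy, Matrix.add_mul, Matrix.smul_mul, Matrix.sub_mul, proj_mul_isotropicState hψ,
      one_mul, trace_add, trace_smul, trace_smul, trace_sub, trace_isotropicState hψ, trace_smul,
      trace_proj hψ]
    push_cast
    simp only [smul_eq_mul]
    ring
  have hΩ' : ((1 - strategy ψ lam) * isotropicState ψ θ).trace = (((1 - lam) * θ : ℝ) : ℂ) := by
    rw [Matrix.sub_mul, trace_sub, hΩ, one_mul, trace_isotropicState hψ]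
    push_cast
    ring
  rw [acceptWith, binomialTail, Finset.mul_sum]
  refine Finset.sum_congr rfl fun i hi => ?_
  have hiN : i ≤ N := (Nat.lt_succ_iff.1 (Finset.mem_range.1 hi)).trans hk
  rw [testOp, trace_tensorOp_mul]
  have : ∀ j : Fin (N + 1), ((if (j : ℕ) < N - i then strategy ψ lam
      else if (j : ℕ) < N then 1 - strategy ψ lam else T) * isotropicState ψ θ).trace =
      if (j : ℕ) < N - i then ((1 - (1 - lam) * θ : ℝ) : ℂ)
      else if (j : ℕ) < N then (((1 - lam) * θ : ℝ) : ℂ) else (τ : ℂ) := by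
    intro j
    split_ifs
    exacts [hΩ, hΩ', hT]
  simp only [this]
  rw [prod_testOp_shape _ _ _ hiN, ← Complex.ofReal_pow, ← Complex.ofReal_pow,
    ← Complex.ofReal_mul, ← Complex.ofReal_mul, Complex.ofReal_re, binomialMass]
  ring

theorem lt_guaranteedInfidelity [Nontrivial ι] {ψ : EuclideanSpace ℂ ι} (hψ : ‖ψ‖ = 1)
    {lam ε δ : ℝ} (hlam1 : lam < 1) (hε0 : 0 < ε) (hε1 : ε < 1) (hδ0 : 0 < δ)
    (hδ1 : δ ≤ 1 / 4) {N k : ℕ} (hk : (1 - lam) * ε * N ≤ k) (hkN : k < N) :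
    ε < guaranteedInfidelity ψ lam k N δ := by
  have hl : 0 < 1 - lam := by linarith
  have hhalf := half_le_binomialTail hkN (s := (1 - lam) * ε) (by positivity) (by linarith)
  have hcont : ContinuousAt (fun θ => binomialTail N k ((1 - lam) * θ)) ε :=
    ContinuousAt.comp (f := fun θ => (1 - lam) * θ)
      (hasDerivAt_binomialTail N k _).continuousAt (by fun_prop)
  -- The gap between 1/2 and 1/4 leaves room to move θ strictly above ε, which makes the final
  -- inequality strict.
  have hev : ∀ᶠ θ in nhds ε, 1 / 4 < binomialTail N k ((1 - lam) * θ) :=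
    hcont.eventually (lt_mem_nhds (by linarith))
  obtain ⟨θ, ⟨hθtail, hθ1⟩, hθ⟩ := (((hev.and (gt_mem_nhds hε1)).filter_mono
    nhdsWithin_le_nhds).and (self_mem_nhdsWithin (s := Set.Ioi ε))).exists
  have hθ : ε < θ := hθ
  have hp : acceptProb ψ lam k N (tensorOp fun _ => isotropicState ψ θ) =
      binomialTail N k ((1 - lam) * θ) := by
    rw [acceptProb, acceptWith_isotropicState hψ lam θ 1 hkN.le, one_mul]
    rw [one_mul, trace_isotropicState hψ, Complex.ofReal_one]
  have hf : acceptWith ψ lam k N (proj ψ) (tensorOp fun _ => isotropicState ψ θ) =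
      (1 - θ) * binomialTail N k ((1 - lam) * θ) := by
    refine acceptWith_isotropicState hψ lam θ (1 - θ) hkN.le _ ?_
    rw [proj_mul_isotropicState hψ, trace_smul, trace_proj hψ, smul_eq_mul, mul_one]
  have hmem : (tensorOp fun _ => isotropicState ψ θ) ∈ feasible ψ lam k N δ := by
    refine ⟨⟨posSemidef_tensorOp fun _ => posSemidef_isotropicState hψ (by linarith) hθ1.le, ?_⟩,
      isPermInvariant_tensorOp _ _, ?_⟩
    · rw [trace_tensorOp]; simp [trace_isotropicState hψ]
    · rw [hp]; linarith
  have hleast := (isLeast_condFidelity hψ lam k N hδ0 (by linarith : δ ≤ 1)).2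
    (Set.mem_image_of_mem _ hmem)
  rw [condFidelity, hp, hf, mul_div_cancel_right₀ _ (by linarith)] at hleast
  linarith

end QSV

theorem proposition2 {ι : Type*} [Fintype ι] [DecidableEq ι] [Nontrivial ι]
    (ψ : EuclideanSpace ℂ ι) (hψ : ‖ψ‖ = 1)
    (lam ε δ : ℝ) (hlam0 : 0 < lam) (hlam1 : lam < 1) (hε0 : 0 < ε) (hε1 : ε < 1)
    (hδ0 : 0 < δ) (hδ1 : δ ≤ 1 / 4) (N k : ℕ) :
    ((1 - lam) * ε * (N : ℝ) ≤ (k : ℝ) → (k : ℝ) ≤ (N : ℝ) - 1 →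
      ε < QSV.guaranteedInfidelity ψ lam k N δ) ∧
    ((k : ℤ) ≤ QSV.failureBound lam N ε δ →
      QSV.guaranteedInfidelity ψ lam k N δ ≤ ε) := by
  refine ⟨fun h1 h2 => ?_, QSV.guaranteedInfidelity_le hψ hlam0 hlam1 hε0 hε1 hδ0 hδ1⟩
  refine QSV.lt_guaranteedInfidelity hψ hlam1 hε0 hε1 hδ0 hδ1 h1 ?_
  have : (k : ℝ) < N := by linarith
  exact_mod_cast this
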